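/- Let $0<c<1/2$, $a=\frac1{2(1-c)}$, $b=\frac1{2c}$, $I=[0,1]$, and let $f_0,f_1:I\to I$ be the piecewise linear increasing homeomorphisms \[ f_0(x)=\begin{cases}ax & 0\le x\le 1-c,\\ 1-b(1-x) & 1-c\le x\le 1,\end{cases}\qquad f_1(x)=\begin{cases}bx & 0\le x\le c,\\ 1-a(1-x) & c\le x\le 1.\end{cases} \] Let $\Sigma=\{0,1\}^{\mathbb Z}$ with the product topology, let $\sigma:\Sigma\to\Sigma$ be the shift $(\sigma\omega)_n=\omega_{n+1}$, and let $F:\Sigma\times I\to\Sigma\times I$ be the invertible skew product $F(\omega,x)=(\sigma\omega,f_{\omega_0}(x))$. Put $G=F^{-1}$; for $n\ge 0$, $m\ge1$ and $\omega\in\Sigma$ let $\phi_{n,m}(\omega)\in I$ be the unique number with $G^n(\omega,\phi_{n,m}(\omega))=(\sigma^{-n}\omega,\frac1m)$, and define $\phi:\Sigma\to I$ by \[ \phi(\omega)=\lim_{m\to\infty}\lim_{N\to\infty}\inf_{n\ge N}\phi_{n,m}(\omega) \] (both limits exist by monotonicity). Then for Lebesgue-almost every $x\in I$ the preimage $\phi^{-1}(x)$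 is dense in $\Sigma$. In particular, the graph $\{(\omega,\phi(\omega)):\omega\in\Sigma\}$ is dense in $\Sigma\times I$. -/

import Mathlib

open Set Filter Topology MeasureTheory
open scoped unitInterval

namespace PLSkew

/-- The space of two-sided sequences `(ω_n)_{n ∈ ℤ}` over the alphabet `{0, 1}`, with the product
topology (of the discrete topology on the alphabet). -/
abbrev Seq : Type := ℤ → Fin 2

/-- The left shift `(σ ω)_n = ω_{n+1}`, an invertible map. -/
def shift : Seq ≃ Seq where
  toFun ω := fun n => ω (n + 1)
  invFun ω := fun n => ω (n - 1)
  left_inv ω := by ext n; simp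
  right_inv ω := by ext n; simp

/-- The slope `a = 1 / (2 (1 - c))`. -/
noncomputable def slopeA (c : ℝ) : ℝ := 1 / (2 * (1 - c))

/-- The slope `b = 1 / (2 c)`. -/
noncomputable def slopeB (c : ℝ) : ℝ := 1 / (2 * c)

/-- The formula of the piecewise linear map `f₀`. -/
noncomputable def f0 (c x : ℝ) : ℝ :=
  if x ≤ 1 - c then slopeA c * x else 1 - slopeB c * (1 - x)

/-- The formula of the piecewise linear map `f₁`. -/
noncomputable def f1 (c x : ℝ) : ℝ :=
  if x ≤ c then slopeB c * x else 1 - slopeA c * (1 - x)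

/-- A map of two linear pieces, from `(0, 0)` to `(p, 1/2)` and from `(p, 1/2)` to `(1, 1)`, is an
increasing bijection of `[0, 1]`. -/
noncomputable def twoPiece (p : ℝ) (hp : p ∈ Ioo (0 : ℝ) 1) (f : ℝ → ℝ)
    (hf : ∀ x, f x = if x ≤ p then 1 / (2 * p) * x else 1 - 1 / (2 * (1 - p)) * (1 - x)) :
    I ≃o I := by
  have h0 : 0 < p := hp.1
  have h1 : 0 < 1 - p := sub_pos.2 hp.2
  have e1 : 1 / (2 * p) * p = 1 / 2 := by field_simp
  have e2 : 1 / (2 * (1 - p)) * (1 - p) = 1 / 2 := by field_simp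
  have k1 : 0 < 1 / (2 * p) := by positivity
  have k2 : 0 < 1 / (2 * (1 - p)) := by positivity
  have hmono : StrictMono f := by
    intro x y hxy
    rw [hf, hf]
    split_ifs <;> nlinarith
  have hmem : ∀ x : I, f x ∈ I := by
    intro x
    have f00 : f 0 = 0 := by rw [hf, if_pos h0.le]; ring
    have f11 : f 1 = 1 := by rw [hf, if_neg (by linarith)]; ring
    exact ⟨f00 ▸ hmono.monotone x.2.1, f11 ▸ hmono.monotone x.2.2⟩
  refine StrictMono.orderIsoOfSurjective (fun x : I => (⟨f x, hmem x⟩ : I))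
    (fun x y h => hmono h) ?_
  rintro ⟨y, hy0, hy1⟩
  by_cases hy : y ≤ 1 / 2
  · refine ⟨⟨2 * p * y, by positivity, by nlinarith [hp.2]⟩, Subtype.ext ?_⟩
    change f (2 * p * y) = y
    rw [hf, if_pos (by nlinarith)]
    field_simp
  · have : 0 ≤ 1 - y := by linarith
    refine ⟨⟨1 - 2 * (1 - p) * (1 - y), by nlinarith, ?_⟩, Subtype.ext ?_⟩
    · have : 0 ≤ 2 * (1 - p) * (1 - y) := by positivity
      linarith
    change f (1 - 2 * (1 - p) * (1 - y)) = y
    rw [hf, if_neg (by nlinarith)]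
    field_simp
    ring

/-- The two fibre maps `f₀`, `f₁ : [0, 1] → [0, 1]`, as increasing bijections of `[0, 1]`. -/
noncomputable def fiberMap (c : ℝ) (hc : c ∈ Ioo (0 : ℝ) (1 / 2)) (j : Fin 2) : I ≃o I :=
  if j = 0 then
    twoPiece (1 - c) ⟨by linarith [hc.2], by linarith [hc.1]⟩ (f0 c) (by
      intro x; simp [f0, slopeA, slopeB])
  else
    twoPiece c ⟨hc.1, by linarith [hc.2]⟩ (f1 c) (by intro x; simp [f1, slopeA, slopeB])

theorem coe_fiberMap_zero (c : ℝ) (hc : c ∈ Ioo (0 : ℝ) (1 / 2)) (x : I) :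
    (fiberMap c hc 0 x : ℝ) = f0 c x := rfl

theorem coe_fiberMap_one (c : ℝ) (hc : c ∈ Ioo (0 : ℝ) (1 / 2)) (x : I) :
    (fiberMap c hc 1 x : ℝ) = f1 c x := rfl

/-- The skew product `F (ω, x) = (σ ω, f_{ω₀} x)`, an invertible map of `Σ × I`. -/
noncomputable def skew (c : ℝ) (hc : c ∈ Ioo (0 : ℝ) (1 / 2)) : Equiv.Perm (Seq × I) where
  toFun p := (shift p.1, fiberMap c hc (p.1 0) p.2)
  invFun p := (shift.symm p.1, (fiberMap c hc (shift.symm p.1 0)).symm p.2)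
  left_inv p := by simp
  right_inv p := by simp

/-- The point `1 / m` of `[0, 1]`. -/
noncomputable def oneDiv (m : ℕ+) : I :=
  ⟨1 / (m : ℝ), by positivity, by
    rw [div_le_one (by exact_mod_cast m.pos)]; exact_mod_cast m.pos⟩

/-- The number `φ_{n,m}(ω)`: the unique point `x` of `[0, 1]` such that
`G^n (ω, x) = (σ^{-n} ω, 1 / m)`, where `G = F⁻¹`; see `skew_inv_pow_eq_iff`. -/
noncomputable def phiNM (c : ℝ) (hc : c ∈ Ioo (0 : ℝ) (1 / 2)) (n : ℕ) (m : ℕ+) (ω : Seq) : I :=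
  ((((skew c hc)⁻¹ ^ n).symm) ((shift.symm)^[n] ω, oneDiv m)).2

/-- The function `φ(ω) = lim_{m → ∞} lim_{N → ∞} inf_{n ≥ N} φ_{n,m}(ω)`; both limits exist, see
`tendsto_inner` and `tendsto_phi`. -/
noncomputable def phi (c : ℝ) (hc : c ∈ Ioo (0 : ℝ) (1 / 2)) (ω : Seq) : I :=
  limUnder atTop fun m : ℕ+ => limUnder atTop fun N : ℕ => ⨅ n ≥ N, phiNM c hc n m ω

theorem skew_inv_pow_fst (c : ℝ) (hc : c ∈ Ioo (0 : ℝ) (1 / 2)) (n : ℕ) (p : Seq × I) :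
    (((skew c hc)⁻¹ ^ n) p).1 = (shift.symm)^[n] p.1 := by
  induction n with
  | zero => rfl
  | succ n ih =>
    rw [pow_succ', Function.iterate_succ_apply', ← ih]; rfl

theorem skew_inv_pow_strictMono (c : ℝ) (hc : c ∈ Ioo (0 : ℝ) (1 / 2)) (n : ℕ) (ω : Seq) :
    StrictMono fun x : I => (((skew c hc)⁻¹ ^ n) (ω, x)).2 := by
  induction n with
  | zero => exact fun x y h => h
  | succ n ih =>
    intro x y h
    have key : ∀ z : I, (((skew c hc)⁻¹ ^ (n + 1)) (ω, z)).2 =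
        (fiberMap c hc (shift.symm ((shift.symm)^[n] ω) 0)).symm
          (((skew c hc)⁻¹ ^ n) (ω, z)).2 := by
      intro z
      rw [← skew_inv_pow_fst c hc n (ω, z), pow_succ']
      rfl
    simp only [key]
    exact (OrderIso.strictMono _) (ih h)

theorem skew_inv_pow_eq_iff (c : ℝ) (hc : c ∈ Ioo (0 : ℝ) (1 / 2)) (n : ℕ) (m : ℕ+) (ω : Seq)
    (x : I) :
    ((skew c hc)⁻¹ ^ n) (ω, x) = ((shift.symm)^[n] ω, oneDiv m) ↔ x = phiNM c hc n m ω := by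
  have h : ((skew c hc)⁻¹ ^ n) (ω, phiNM c hc n m ω) = ((shift.symm)^[n] ω, oneDiv m) := by
    set q := (((skew c hc)⁻¹ ^ n).symm) ((shift.symm)^[n] ω, oneDiv m) with hq
    have h1 : ((skew c hc)⁻¹ ^ n) q = ((shift.symm)^[n] ω, oneDiv m) := by
      rw [hq, Equiv.apply_symm_apply]
    have h2 : q.1 = ω := by
      have := skew_inv_pow_fst c hc n q
      rw [h1] at this
      exact (Function.Injective.iterate shift.symm.injective n this).symm
    have h3 : (ω, phiNM c hc n m ω) = q := Prod.ext h2.symm rfl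
    rw [h3, h1]
  constructor
  · intro hx
    have := ((skew c hc)⁻¹ ^ n).injective (hx.trans h.symm)
    exact (Prod.ext_iff.1 this).2
  · rintro rfl; exact h

theorem phiNM_antitone (c : ℝ) (hc : c ∈ Ioo (0 : ℝ) (1 / 2)) (n : ℕ) (ω : Seq) :
    Antitone fun m : ℕ+ => phiNM c hc n m ω := by
  intro m k hmk
  rw [← (skew_inv_pow_strictMono c hc n ω).le_iff_le]
  have e : ∀ m, (((skew c hc)⁻¹ ^ n) (ω, phiNM c hc n m ω)).2 = oneDiv m := fun m => by
    rw [(skew_inv_pow_eq_iff c hc n m ω _).2 rfl]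
  simp only [e]
  change (1 : ℝ) / (k : ℝ) ≤ 1 / (m : ℝ)
  exact one_div_le_one_div_of_le (by exact_mod_cast m.pos) (by exact_mod_cast hmk)

/-- The inner limit in the definition of `φ` exists. -/
theorem tendsto_inner (c : ℝ) (hc : c ∈ Ioo (0 : ℝ) (1 / 2)) (m : ℕ+) (ω : Seq) :
    Tendsto (fun N : ℕ => ⨅ n ≥ N, phiNM c hc n m ω) atTop
      (𝓝 (⨆ N : ℕ, ⨅ n ≥ N, phiNM c hc n m ω)) :=
  tendsto_atTop_iSup fun _ _ h => biInf_mono fun _ hi => le_trans h hi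

/-- The outer limit in the definition of `φ` exists. -/
theorem tendsto_phi (c : ℝ) (hc : c ∈ Ioo (0 : ℝ) (1 / 2)) (ω : Seq) :
    Tendsto (fun m : ℕ+ => limUnder atTop fun N : ℕ => ⨅ n ≥ N, phiNM c hc n m ω) atTop
      (𝓝 (phi c hc ω)) := by
  refine tendsto_nhds_limUnder
    ⟨⨅ m : ℕ+, ⨆ N : ℕ, ⨅ n ≥ N, phiNM c hc n m ω, ?_⟩
  simp only [fun m => (tendsto_inner c hc m ω).limUnder_eq]
  exact tendsto_atTop_iInf fun m k h =>
    iSup_mono fun N => iInf₂_mono fun n _ => phiNM_antitone c hc n ω h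

end PLSkew

open Set Filter Topology MeasureTheory
open scoped unitInterval

namespace PLSkew

/-! ### An expanding interval map and the points below its orbits -/

section Expanding

variable {α : ℝ}

/-! Fix `x` in `(0, 1)`. At each point one of the two inverse fibre maps expands with slope `α = 2
(1 - c) > 1`. Keep the coordinates of a given sequence from `-k` on, and let every earlier
coordinate select the map expanding at the current backward iterate of `x`. This iterate exceeds
`1/2` infinitely often, while every orbit starting below `x` tends to `0` (`tendsto_follow`): its
ratio to the orbit of `x` never grows after time `k`, and shrinks by a fixed factor at each return
of that orbit beyond `1/2 + δ` (`exists_recurrence`). So `φ = x` at the new sequence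
(`phi_eq_of_tendsto`), and `k → ∞` gives density. -/

/-- The expanding map `y ↦ α y` on `[0, 1/2]`, `y ↦ 1 - α (1 - y)` on `(1/2, 1]`. -/
noncomputable def expand (α y : ℝ) : ℝ := if y ≤ 1 / 2 then α * y else 1 - α * (1 - y)

theorem expand_mem (h1 : 1 < α) (h2 : α < 2) {y : ℝ} (hy : y ∈ Ioo (0 : ℝ) 1) :
    expand α y ∈ Ioo (0 : ℝ) 1 := by
  obtain ⟨h0, h3⟩ := hy
  unfold expand
  split_ifs with h
  · exact ⟨by positivity, by nlinarith⟩
  · push Not at h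
    exact ⟨by nlinarith, by nlinarith⟩

theorem expand_iterate_mem (h1 : 1 < α) (h2 : α < 2) {y : ℝ} (hy : y ∈ Ioo (0 : ℝ) 1) (n : ℕ) :
    (expand α)^[n] y ∈ Ioo (0 : ℝ) 1 := by
  induction n with
  | zero => exact hy
  | succ n ih => rw [Function.iterate_succ_apply']; exact expand_mem h1 h2 ih

/-- An orbit of `expand` that starts at a positive point first exceeds `1/2` after finitely many
multiplications by `α`. -/
theorem exists_expand_iterate_gt (h1 : 1 < α) {y : ℝ} (hy : 0 < y) :
    ∃ n, 1 / 2 < α ^ n * y ∧ (expand α)^[n] y = α ^ n * y := by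
  classical
  have hex : ∃ n, 1 / 2 < α ^ n * y := by
    obtain ⟨n, hn⟩ := pow_unbounded_of_one_lt (1 / 2 / y) h1
    exact ⟨n, by rwa [div_lt_iff₀ hy] at hn⟩
  have hmin : ∀ i < Nat.find hex, α ^ i * y ≤ 1 / 2 := fun i hi => not_lt.1 (Nat.find_min hex hi)
  refine ⟨Nat.find hex, Nat.find_spec hex, ?_⟩
  have key : ∀ n ≤ Nat.find hex, (expand α)^[n] y = α ^ n * y := by
    intro n
    induction n with
    | zero => simp
    | succ n ih =>
      intro hn
      rw [Function.iterate_succ_apply', ih (by omega), expand, if_pos (hmin n (by omega))]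
      ring
  exact key _ le_rfl

/-- Orbits of `expand` come back to the right of a fixed point `1/2 + δ > 1/2`. -/
theorem exists_recurrence (h1 : 1 < α) (h2 : α < 2) :
    ∃ δ > 0, ∀ y ∈ Ioo (0 : ℝ) 1, ∃ n, 1 / 2 + δ ≤ (expand α)^[n] y := by
  classical
  -- The value of the right branch at `1/2`; for `α = 2 (1 - c)` it is the parameter of the fibre
  -- maps.
  set c := 1 - α / 2 with hc
  have hc0 : 0 < c := by rw [hc]; linarith
  have hex : ∃ n, 1 / 2 ≤ α ^ n * c := by
    obtain ⟨n, hn, _⟩ := exists_expand_iterate_gt h1 hc0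
    exact ⟨n, hn.le⟩
  obtain ⟨k, hk⟩ : ∃ k, Nat.find hex = k + 1 := by
    refine Nat.exists_eq_succ_of_ne_zero fun h => ?_
    have := Nat.find_spec hex
    rw [h, pow_zero, one_mul] at this
    linarith
  have hk1 : α ^ k * c < 1 / 2 := not_le.1 (Nat.find_min hex (by omega))
  have hk2 : 1 / 2 ≤ α ^ (k + 1) * c := hk ▸ Nat.find_spec hex
  have hα : 0 < α := by linarith
  -- `δ` solves `α ^ k * (c + α * δ) = 1 / 2`: an orbit in `(1/2, 1/2 + δ)` needs at least `k + 1`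
  -- multiplications to exceed `1/2` again, and by then `c` alone has grown to `1/2`. The excess
  -- over `1/2` thus grows by a factor `α` at least.
  refine ⟨(1 / 2 - α ^ k * c) / α ^ (k + 1), div_pos (by linarith) (by positivity), ?_⟩
  set δ := (1 / 2 - α ^ k * c) / α ^ (k + 1) with hδ
  have hδe : α ^ k * (c + α * δ) = 1 / 2 := by
    rw [hδ]; field_simp; ring
  have step : ∀ t, 0 < t → t < δ → ∀ y ∈ Ioo (0 : ℝ) 1, 1 / 2 + t ≤ y → y < 1 / 2 + δ →
      ∃ n, 1 / 2 + α * t ≤ (expand α)^[n] y := by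
    intro t ht htδ y hy hty hyδ
    have e : expand α y = c + α * (y - 1 / 2) := by
      rw [expand, if_neg (by linarith), hc]; ring
    have hp : 0 < expand α y := (expand_mem h1 h2 hy).1
    obtain ⟨n, hn, hne⟩ := exists_expand_iterate_gt h1 hp
    refine ⟨n + 1, ?_⟩
    rw [Function.iterate_succ_apply, hne]
    have hkn : k + 1 ≤ n := by
      by_contra hlt
      have hnk : n ≤ k := by omega
      have h3 : α ^ n * expand α y ≤ α ^ k * expand α y :=
        mul_le_mul_of_nonneg_right (pow_le_pow_right₀ h1.le hnk) hp.le
      have h4 : α ^ k * expand α y ≤ α ^ k * (c + α * δ) := by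
        rw [e]
        have : y - 1 / 2 ≤ δ := by linarith
        gcongr
      linarith
    have h5 : 1 / 2 ≤ α ^ n * c :=
      hk2.trans (mul_le_mul_of_nonneg_right (pow_le_pow_right₀ h1.le hkn) hc0.le)
    have h6 : α * t ≤ α ^ n * (α * (y - 1 / 2)) := by
      have h7 : α * t ≤ α * (y - 1 / 2) := by
        have : t ≤ y - 1 / 2 := by linarith
        gcongr
      have h8 : 0 ≤ α * (y - 1 / 2) := le_trans (by positivity) h7
      exact h7.trans (le_mul_of_one_le_left h8 (one_le_pow₀ h1.le))
    rw [e, mul_add]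
    linarith
  intro y hy
  by_contra! hcon
  obtain ⟨n₀, hn₀, hne⟩ := exists_expand_iterate_gt h1 hy.1
  rw [← hne] at hn₀
  set t := (expand α)^[n₀] y - 1 / 2 with ht
  have ht0 : 0 < t := by linarith
  have grow : ∀ j : ℕ, ∃ n, 1 / 2 + α ^ j * t ≤ (expand α)^[n] y := by
    intro j
    induction j with
    | zero => exact ⟨n₀, by rw [ht]; linarith⟩
    | succ j ih =>
      obtain ⟨n, hn⟩ := ih
      obtain ⟨m, hm⟩ := step (α ^ j * t) (by positivity) (by linarith [hcon n]) _
        (expand_iterate_mem h1 h2 hy n) hn (hcon n)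
      refine ⟨m + n, ?_⟩
      rw [Function.iterate_add_apply, pow_succ']
      linarith
  obtain ⟨j, hj⟩ := pow_unbounded_of_one_lt (δ / t) h1
  rw [div_lt_iff₀ ht0] at hj
  obtain ⟨n, hn⟩ := grow j
  linarith [hcon n]

/-- The map that acts on a point `z` below the point `y` when `y` moves by `expand`. -/
noncomputable def follow (α y z : ℝ) : ℝ :=
  if y ≤ 1 / 2 then α * z else if z ≤ 1 / 2 then (2 - α) * z else 1 - α * (1 - z)

/-- Left of `1/2` both points are scaled by `α`. Otherwise the map is convex and fixes `0` (slopes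
`2 - α < α`), so the lower point is stretched by no larger a ratio. -/
theorem follow_le (h1 : 1 < α) (h2 : α < 2) {y z ρ : ℝ} (hρ0 : 0 ≤ ρ) (hρ : ρ ≤ 1)
    (hz : z ≤ ρ * y) : follow α y z ≤ ρ * expand α y := by
  unfold follow expand
  split_ifs with h h'
  · nlinarith
  · push Not at h
    have e1 : (2 - α) * z ≤ (2 - α) * (ρ * y) := mul_le_mul_of_nonneg_left hz (by linarith)
    have e2 : 0 ≤ ρ * ((α - 1) * (2 * y - 1)) :=
      mul_nonneg hρ0 (mul_nonneg (by linarith) (by linarith))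
    linarith
  · have e1 : α * z ≤ α * (ρ * y) := mul_le_mul_of_nonneg_left hz (by linarith)
    have e2 : 0 ≤ (α - 1) * (1 - ρ) := mul_nonneg (by linarith) (by linarith)
    linarith

/-- Convexity gains `(α - 1) * ρ * (2 * y - 1)` or `(α - 1) * (1 - ρ)`, each at least `(α - 1) * ε *
ρ`; the gain becomes a factor because `expand α y < 1`. -/
theorem follow_le_of_gap (h1 : 1 < α) (h2 : α < 2) {y z ρ δ ε : ℝ} (hδ : 0 < δ)
    (hy : y ∈ Ioo (0 : ℝ) 1) (hyδ : 1 / 2 + δ ≤ y) (hρ0 : 0 ≤ ρ) (hε : 0 ≤ ε) (hεδ : ε ≤ 2 * δ)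
    (hρ : ρ ≤ 1 - ε) (hz : z ≤ ρ * y) :
    follow α y z ≤ (1 - (α - 1) * ε) * ρ * expand α y := by
  have hE := expand_mem h1 h2 hy
  have e0 : (α - 1) * ε * ρ * expand α y ≤ (α - 1) * ε * ρ :=
    mul_le_of_le_one_right (mul_nonneg (mul_nonneg (by linarith) hε) hρ0) hE.2.le
  have he : expand α y = 1 - α * (1 - y) := by rw [expand, if_neg (by linarith)]
  suffices h : follow α y z + (α - 1) * ε * ρ ≤ ρ * expand α y by linarith
  rw [he]
  unfold follow
  rw [if_neg (by linarith)]
  split_ifs with h'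
  · have e1 : (2 - α) * z ≤ (2 - α) * (ρ * y) := mul_le_mul_of_nonneg_left hz (by linarith)
    have e2 : (α - 1) * ρ * ε ≤ (α - 1) * ρ * (2 * y - 1) :=
      mul_le_mul_of_nonneg_left (by linarith) (mul_nonneg (by linarith) hρ0)
    linarith
  · have e1 : α * z ≤ α * (ρ * y) := mul_le_mul_of_nonneg_left hz (by linarith)
    have e2 : (α - 1) * ε ≤ (α - 1) * (1 - ρ) :=
      mul_le_mul_of_nonneg_left (by linarith) (by linarith)
    have e3 : (α - 1) * ε * ρ ≤ (α - 1) * ε :=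
      mul_le_of_le_one_right (mul_nonneg (by linarith) hε) (by linarith)
    linarith

/-- Every point below the start of an orbit of `expand` is driven to `0` by `follow`. -/
theorem tendsto_follow (h1 : 1 < α) (h2 : α < 2) {Y Z : ℕ → ℝ} (hY0 : Y 0 ∈ Ioo (0 : ℝ) 1)
    (hY : ∀ n, Y (n + 1) = expand α (Y n)) (hZ0 : ∀ n, 0 ≤ Z n) (hZY : Z 0 < Y 0)
    (hZ : ∀ n, Z (n + 1) = follow α (Y n) (Z n)) : Tendsto Z atTop (𝓝 0) := by
  obtain ⟨δ, hδ, hrec⟩ := exists_recurrence h1 h2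
  have hmem : ∀ n, Y n ∈ Ioo (0 : ℝ) 1 := by
    intro n
    induction n with
    | zero => exact hY0
    | succ n ih => rw [hY]; exact expand_mem h1 h2 ih
  have hiter : ∀ n m, Y (m + n) = (expand α)^[m] (Y n) := by
    intro n m
    induction m with
    | zero => simp
    | succ m ih => rw [Function.iterate_succ_apply', ← ih, ← hY]; congr 1; omega
  set ρ := Z 0 / Y 0 with hρ
  have hρ0 : 0 ≤ ρ := div_nonneg (hZ0 0) hY0.1.le
  have hρ1 : ρ < 1 := (div_lt_one hY0.1).2 hZY
  -- One `ε` serves all returns, since the bound on the ratio only decreases from `ρ`.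
  set ε := min (2 * δ) (1 - ρ) with hε
  have hε0 : 0 < ε := lt_min (by linarith) (by linarith)
  have hε1 : ε ≤ 1 - ρ := min_le_right _ _
  set θ := 1 - (α - 1) * ε with hθ
  have hθ0 : 0 ≤ θ := by nlinarith
  have hθ1 : θ < 1 := by nlinarith
  have hle : ∀ j : ℕ, θ ^ j * ρ ≤ ρ := fun j =>
    mul_le_of_le_one_left hρ0 (pow_le_one₀ hθ0 hθ1.le)
  have persist : ∀ (j n : ℕ), Z n ≤ θ ^ j * ρ * Y n → ∀ m, Z (m + n) ≤ θ ^ j * ρ * Y (m + n) := by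
    intro j n hn m
    induction m with
    | zero => simpa using hn
    | succ m ih =>
      rw [show m + 1 + n = (m + n) + 1 by omega, hZ, hY]
      exact follow_le h1 h2 (by positivity) ((hle j).trans hρ1.le) ih
  have key : ∀ j : ℕ, ∃ n, Z n ≤ θ ^ j * ρ * Y n := by
    intro j
    induction j with
    | zero => exact ⟨0, by rw [hρ, pow_zero, one_mul, div_mul_cancel₀ _ hY0.1.ne']⟩
    | succ j ih =>
      obtain ⟨n, hn⟩ := ih
      obtain ⟨m, hm⟩ := hrec (Y n) (hmem n)
      rw [← hiter] at hm
      refine ⟨m + n + 1, ?_⟩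
      rw [hZ, hY, pow_succ', mul_assoc θ]
      exact follow_le_of_gap h1 h2 hδ (hmem _) hm (by positivity) hε0.le (min_le_left _ _)
        ((hle j).trans (by linarith)) (persist j n hn m)
  rw [Metric.tendsto_atTop]
  intro e he
  obtain ⟨j, hj⟩ := exists_pow_lt_of_lt_one he hθ1
  obtain ⟨n, hn⟩ := key j
  refine ⟨n, fun m hm => ?_⟩
  obtain ⟨i, rfl⟩ := Nat.exists_eq_add_of_le' hm
  rw [Real.dist_eq, sub_zero, abs_of_nonneg (hZ0 _)]
  have h3 := persist j n hn i
  have h4 : θ ^ j * ρ * Y (i + n) ≤ θ ^ j * ρ :=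
    mul_le_of_le_one_right (by positivity) (hmem _).2.le
  have h5 : θ ^ j * ρ ≤ θ ^ j := mul_le_of_le_one_right (by positivity) hρ1.le
  linarith

end Expanding

/-! ### Inverse fibre maps, the threshold `φ`, and steered sequences -/

section Fibre

variable {c : ℝ} (hc : c ∈ Ioo (0 : ℝ) (1 / 2))

theorem coe_fiberMap_zero_symm (y : I) : ((fiberMap c hc 0).symm y : ℝ) =
    if (y : ℝ) ≤ 1 / 2 then 2 * (1 - c) * y else 1 - 2 * c * (1 - y) := by
  obtain ⟨x, rfl⟩ := (fiberMap c hc 0).surjective y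
  have h0 := hc.1
  have h1 := hc.2
  have hb : 0 < 1 - c := by linarith
  rw [OrderIso.symm_apply_apply, coe_fiberMap_zero, f0, slopeA, slopeB]
  have e1 : 1 / (2 * (1 - c)) * (1 - c) = 1 / 2 := by field_simp
  have e2 : 1 / (2 * c) * c = 1 / 2 := by field_simp
  have k1 : 0 < 1 / (2 * (1 - c)) := by positivity
  have k2 : 0 < 1 / (2 * c) := by positivity
  by_cases hx : (x : ℝ) ≤ 1 - c
  · rw [if_pos hx, if_pos (by nlinarith)]
    field_simp
  · rw [if_neg hx, if_neg (by nlinarith)]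
    field_simp
    ring

theorem coe_fiberMap_one_symm (y : I) : ((fiberMap c hc 1).symm y : ℝ) =
    if (y : ℝ) ≤ 1 / 2 then 2 * c * y else 1 - 2 * (1 - c) * (1 - y) := by
  obtain ⟨x, rfl⟩ := (fiberMap c hc 1).surjective y
  have h0 := hc.1
  have h1 := hc.2
  have hb : 0 < 1 - c := by linarith
  rw [OrderIso.symm_apply_apply, coe_fiberMap_one, f1, slopeA, slopeB]
  have e1 : 1 / (2 * (1 - c)) * (1 - c) = 1 / 2 := by field_simp
  have e2 : 1 / (2 * c) * c = 1 / 2 := by field_simp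
  have k1 : 0 < 1 / (2 * (1 - c)) := by positivity
  have k2 : 0 < 1 / (2 * c) := by positivity
  by_cases hx : (x : ℝ) ≤ c
  · rw [if_pos hx, if_pos (by nlinarith)]
    field_simp
  · rw [if_neg hx, if_neg (by nlinarith)]
    field_simp
    ring

/-- The symbol whose inverse fibre map expands around `y`. -/
noncomputable def expandingSymbol (y : I) : Fin 2 := if (y : ℝ) ≤ 1 / 2 then 0 else 1

theorem coe_fiberMap_expandingSymbol_symm (y : I) :
    ((fiberMap c hc (expandingSymbol y)).symm y : ℝ) = expand (2 * (1 - c)) y := by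
  unfold expandingSymbol expand
  split_ifs with h
  · rw [coe_fiberMap_zero_symm, if_pos h]
  · rw [coe_fiberMap_one_symm, if_neg h]

theorem coe_fiberMap_expandingSymbol_symm_of_lt {y z : I} (hzy : z < y) :
    ((fiberMap c hc (expandingSymbol y)).symm z : ℝ) = follow (2 * (1 - c)) y z := by
  have hlt : (z : ℝ) < y := hzy
  unfold expandingSymbol follow
  split_ifs with h h'
  · rw [coe_fiberMap_zero_symm, if_pos (by linarith)]
  · rw [coe_fiberMap_one_symm, if_pos h']; ring
  · rw [coe_fiberMap_one_symm, if_neg h']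

/-- Undoing a step from `σ^{-n} ω` reads coordinate `0` of `σ^{-(n+1)} ω`, so backward orbits see
only negative coordinates. -/
theorem skew_inv_pow_succ_snd (n : ℕ) (ω : Seq) (x : I) :
    (((skew c hc)⁻¹ ^ (n + 1)) (ω, x)).2 =
      (fiberMap c hc (ω (-(n : ℤ) - 1))).symm (((skew c hc)⁻¹ ^ n) (ω, x)).2 := by
  have hsh : ∀ (n : ℕ) (i : ℤ), (shift.symm)^[n] ω i = ω (i - n) := by
    intro n
    induction n with
    | zero => simp
    | succ n ih =>
      intro i
      rw [Function.iterate_succ_apply']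
      change (shift.symm)^[n] ω (i - 1) = _
      rw [ih]; congr 1; push_cast; ring
  have hfst := skew_inv_pow_fst c hc n (ω, x)
  have e : ω (-(n : ℤ) - 1) = shift.symm (((skew c hc)⁻¹ ^ n) (ω, x)).1 0 := by
    rw [hfst]
    change _ = (shift.symm)^[n] ω (0 - 1)
    rw [hsh]; congr 1; ring
  rw [e, pow_succ']
  rfl

theorem lt_phiNM_iff (n : ℕ) (m : ℕ+) (ω : Seq) (x : I) :
    x < phiNM c hc n m ω ↔ (((skew c hc)⁻¹ ^ n) (ω, x)).2 < oneDiv m := by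
  rw [← (skew_inv_pow_strictMono c hc n ω).lt_iff_lt]
  simp only [(skew_inv_pow_eq_iff c hc n m ω _).2 rfl]

theorem phiNM_lt_iff (n : ℕ) (m : ℕ+) (ω : Seq) (x : I) :
    phiNM c hc n m ω < x ↔ oneDiv m < (((skew c hc)⁻¹ ^ n) (ω, x)).2 := by
  rw [← (skew_inv_pow_strictMono c hc n ω).lt_iff_lt]
  simp only [(skew_inv_pow_eq_iff c hc n m ω _).2 rfl]

theorem phi_eq_iInf (ω : Seq) :
    phi c hc ω = ⨅ m : ℕ+, ⨆ N : ℕ, ⨅ n ≥ N, phiNM c hc n m ω := by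
  refine tendsto_nhds_unique (tendsto_phi c hc ω) ?_
  simp only [fun m => (tendsto_inner c hc m ω).limUnder_eq]
  exact tendsto_atTop_iInf fun m k h =>
    iSup_mono fun N => iInf₂_mono fun n _ => phiNM_antitone c hc n ω h

/-- `φ(ω)` separates the points attracted to `0` by the backward orbit of `ω` from the rest. -/
theorem phi_eq_of_tendsto {ω : Seq} {x : I}
    (hlow : ∀ z < x, Tendsto (fun n => (((skew c hc)⁻¹ ^ n) (ω, z)).2) atTop (𝓝 0))
    (hhigh : ∃ᶠ n in atTop, (1 / 2 : ℝ) < (((skew c hc)⁻¹ ^ n) (ω, x)).2) :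
    phi c hc ω = x := by
  rw [phi_eq_iInf]
  apply le_antisymm
  -- `m = 2` suffices: `φ_{n,2}(ω) < x` exactly when the orbit of `x` is above `1/2` at time `n`.
  · refine (iInf_le _ (2 : ℕ+)).trans (iSup_le fun N => ?_)
    obtain ⟨n, hn, hlt⟩ := frequently_atTop.1 hhigh N
    refine (iInf₂_le n hn).trans (le_of_lt ?_)
    rw [phiNM_lt_iff, ← Subtype.coe_lt_coe]
    simpa [oneDiv] using hlt
  · refine le_iInf fun m => le_of_forall_lt fun z hz => ?_
    obtain ⟨z', hz', hz'x⟩ := exists_between hz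
    have hpos : (0 : I) < oneDiv m := by
      rw [← Subtype.coe_lt_coe]
      simp [oneDiv]
    obtain ⟨N, hN⟩ := eventually_atTop.1 ((hlow z' hz'x).eventually_lt_const hpos)
    refine hz'.trans_le (le_iSup_of_le N (le_iInf₂ fun n hn => le_of_lt ?_))
    rw [lt_phiNM_iff]
    exact hN n hn

/-- The symbol used at step `n`: that of `ω₀` for `n < k`, the expanding one afterwards. -/
noncomputable def steeredSymbol (ω₀ : Seq) (k n : ℕ) (y : I) : Fin 2 :=
  if n < k then ω₀ (-(n : ℤ) - 1) else expandingSymbol y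

/-- The backward orbit of `x` steered by `steeredSymbol`. -/
noncomputable def steeredOrbit (ω₀ : Seq) (k : ℕ) (x : I) : ℕ → I
  | 0 => x
  | n + 1 => (fiberMap c hc (steeredSymbol ω₀ k n (steeredOrbit ω₀ k x n))).symm
      (steeredOrbit ω₀ k x n)

/-- The sequence whose backward fibre maps produce `steeredOrbit`. -/
noncomputable def steeredSeq (ω₀ : Seq) (k : ℕ) (x : I) : Seq := fun i =>
  if 0 ≤ i then ω₀ i else
    steeredSymbol ω₀ k (-i - 1).toNat (steeredOrbit hc ω₀ k x (-i - 1).toNat)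

theorem steeredSeq_neg (ω₀ : Seq) (k : ℕ) (x : I) (n : ℕ) :
    steeredSeq hc ω₀ k x (-(n : ℤ) - 1) =
      steeredSymbol ω₀ k n (steeredOrbit hc ω₀ k x n) := by
  have e : (-(-(n : ℤ) - 1) - 1).toNat = n := by omega
  rw [steeredSeq, if_neg (by omega), e]

theorem steeredSeq_of_le (ω₀ : Seq) (k : ℕ) (x : I) {i : ℤ} (hi : -(k : ℤ) ≤ i) :
    steeredSeq hc ω₀ k x i = ω₀ i := by
  by_cases h : 0 ≤ i
  · rw [steeredSeq, if_pos h]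
  · rw [steeredSeq, if_neg h, steeredSymbol, if_pos (by omega)]
    congr 1; omega

/-- The choice is not circular: coordinate `-n - 1` is first read in leaving time `n`, and depends
only on the position reached by then. -/
theorem skew_inv_pow_steeredSeq (ω₀ : Seq) (k : ℕ) (x : I) (n : ℕ) :
    (((skew c hc)⁻¹ ^ n) (steeredSeq hc ω₀ k x, x)).2 = steeredOrbit hc ω₀ k x n := by
  induction n with
  | zero => rfl
  | succ n ih => rw [skew_inv_pow_succ_snd, ih, steeredSeq_neg, steeredOrbit]

theorem steeredOrbit_mem (ω₀ : Seq) (k : ℕ) {x : I} (hx : x ∈ Ioo (0 : I) 1) (n : ℕ) :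
    steeredOrbit hc ω₀ k x n ∈ Ioo (0 : I) 1 := by
  induction n with
  | zero => exact hx
  | succ n ih =>
    rw [steeredOrbit]
    set e := (fiberMap c hc (steeredSymbol ω₀ k n (steeredOrbit hc ω₀ k x n))).symm
    have h0 : e 0 = 0 := e.map_bot
    have h1 : e 1 = 1 := e.map_top
    exact ⟨h0 ▸ e.strictMono ih.1, h1 ▸ e.strictMono ih.2⟩

theorem phi_steeredSeq (ω₀ : Seq) (k : ℕ) {x : I} (hx : x ∈ Ioo (0 : I) 1) :
    phi c hc (steeredSeq hc ω₀ k x) = x := by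
  have h1 : 1 < 2 * (1 - c) := by linarith [hc.2]
  have h2 : 2 * (1 - c) < 2 := by linarith [hc.1]
  have hsym : ∀ n, steeredSymbol ω₀ k (n + k) (steeredOrbit hc ω₀ k x (n + k)) =
      expandingSymbol (steeredOrbit hc ω₀ k x (n + k)) := fun n => by
    rw [steeredSymbol, if_neg (by omega)]
  have hY : ∀ n, (steeredOrbit hc ω₀ k x (n + 1 + k) : ℝ) =
      expand (2 * (1 - c)) (steeredOrbit hc ω₀ k x (n + k)) := fun n => by
    rw [show n + 1 + k = (n + k) + 1 by omega, steeredOrbit, hsym,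
      coe_fiberMap_expandingSymbol_symm]
  have hmem : ∀ n, (steeredOrbit hc ω₀ k x n : ℝ) ∈ Ioo (0 : ℝ) 1 := fun n =>
    steeredOrbit_mem hc ω₀ k hx n
  refine phi_eq_of_tendsto hc (fun z hz => ?_) (frequently_atTop.2 fun N => ?_)
  · have hlt : ∀ n, (((skew c hc)⁻¹ ^ n) (steeredSeq hc ω₀ k x, z)).2 <
        steeredOrbit hc ω₀ k x n := fun n => by
      rw [← skew_inv_pow_steeredSeq]
      exact skew_inv_pow_strictMono c hc n _ hz
    -- The first `k` steps follow `ω₀` and need not expand; strict order survives them, so the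
    -- comparison can start at time `k`.
    rw [← tendsto_add_atTop_iff_nat k, tendsto_subtype_rng]
    refine tendsto_follow h1 h2 (Y := fun n => (steeredOrbit hc ω₀ k x (n + k) : ℝ)) (hmem _) hY
      (fun n => (((skew c hc)⁻¹ ^ (n + k)) (steeredSeq hc ω₀ k x, z)).2.2.1) (hlt _) fun n => ?_
    rw [show n + 1 + k = (n + k) + 1 by omega, skew_inv_pow_succ_snd, steeredSeq_neg, hsym,
      coe_fiberMap_expandingSymbol_symm_of_lt hc (hlt _)]
  · obtain ⟨n, hn, hne⟩ := exists_expand_iterate_gt h1 (hmem (N + k)).1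
    have hiter : ∀ m, (steeredOrbit hc ω₀ k x (m + N + k) : ℝ) =
        (expand (2 * (1 - c)))^[m] (steeredOrbit hc ω₀ k x (N + k)) := by
      intro m
      induction m with
      | zero => simp
      | succ m ih =>
        rw [Function.iterate_succ_apply', ← ih, ← hY, show m + 1 + N = m + N + 1 by omega]
    refine ⟨n + N + k, by omega, ?_⟩
    rw [skew_inv_pow_steeredSeq, hiter, hne]
    exact hn

theorem dense_phi_preimage {x : I} (hx : x ∈ Ioo (0 : I) 1) : Dense (phi c hc ⁻¹' {x}) := by
  intro ω₀
  refine mem_closure_of_tendsto (f := fun k : ℕ => steeredSeq hc ω₀ k x) (b := atTop) ?_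
    (Eventually.of_forall fun k => phi_steeredSeq hc ω₀ k hx)
  refine tendsto_pi_nhds.2 fun i => tendsto_const_nhds.congr' ?_
  filter_upwards [eventually_ge_atTop i.natAbs] with k hk
  exact (steeredSeq_of_le hc ω₀ k x (by omega)).symm

end Fibre

end PLSkew

/-! ### Dense level sets and the dense graph -/

theorem theorem6p3 (c : ℝ) (hc : c ∈ Set.Ioo (0 : ℝ) (1 / 2)) :
    (∀ᵐ x : unitInterval ∂MeasureTheory.volume, Dense (PLSkew.phi c hc ⁻¹' {x})) ∧
      Dense {p : PLSkew.Seq × unitInterval | p.2 = PLSkew.phi c hc p.1} := by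
  have hIoo : ∀ x : I, x ≠ 0 → x ≠ 1 → x ∈ Ioo (0 : I) 1 := fun x h0 h1 =>
    ⟨unitInterval.pos_iff_ne_zero.2 h0, unitInterval.lt_one_iff_ne_one.2 h1⟩
  constructor
  · filter_upwards [Measure.ae_ne volume (0 : I), Measure.ae_ne volume (1 : I)] with x h0 h1
    exact PLSkew.dense_phi_preimage hc (hIoo x h0 h1)
  · rw [dense_iff_inter_open]
    rintro U hU ⟨⟨ω, x⟩, hp⟩
    obtain ⟨V, W, hV, hW, hωV, hxW, hVW⟩ := isOpen_prod_iff.1 hU ω x hp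
    -- The given height may be an endpoint, so it is first moved to an interior one.
    have hd : Dense (univ \ {0, 1} : Set I) := dense_univ.sdiff_finite (toFinite _)
    obtain ⟨y, hyW, hy⟩ := hd.inter_open_nonempty W hW ⟨x, hxW⟩
    simp only [Set.mem_sdiff, mem_univ, true_and, mem_insert_iff, mem_singleton_iff, not_or] at hy
    obtain ⟨η, hηV, hη⟩ := (PLSkew.dense_phi_preimage hc (hIoo y hy.1 hy.2)).inter_open_nonempty
      V hV ⟨ω, hωV⟩
    exact ⟨(η, y), hVW ⟨hηV, hyW⟩, (hη : PLSkew.phi c hc η = y).symm⟩
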